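/- Let $K$ be a finite field of characteristic $p$ and order $q$, and let $\psi_K(x)=\exp\bigl(2\pi i\,\mathrm{Tr}_{K/\mathbb F_p}(x)/p\bigr)$ be its canonical additive character. Let $d$ be a non-negative integer with $\gcd(d,q-1)=1$, and for $a\in K$ put $$W_{K,d}(a)=\sum_{x\in K}\psi_K(x^d+ax).$$ Let $s$ be the $2$-adic valuation of $[K:\mathbb F_p]$. If $W_{K,d}$ is symmetric three-valued with values $0,\pm A$, that is, if the set $\{W_{K,d}(a):a\in K^\times\}$ has exactly three elements and equals $\{0,A,-A\}$ for some $A \in \mathbb C$, then $$|A|\ \ge\ p^{2^{s-1}}\sqrt q .$$ (When $s=0$ the factor $p^{2^{s-1}}$ is $p^{1/2}$.) -/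

import Mathlib

/-- The canonical additive character `x ↦ exp (2πi Tr(x) / p)` of a finite field `K` of
characteristic `p`, where `Tr` is the absolute trace `K → 𝔽_p`. -/
noncomputable def canonicalChar (p : ℕ) [Fact p.Prime] (K : Type*) [Field K]
    [Algebra (ZMod p) K] : AddChar K ℂ :=
  (ZMod.stdAddChar (N := p)).compAddMonoidHom (Algebra.trace (ZMod p) K).toAddMonoidHom

/-- The character is given by the usual exponential formula. -/
theorem canonicalChar_eq_exp (p : ℕ) [Fact p.Prime] (K : Type*) [Field K]
    [Algebra (ZMod p) K] (x : K) :
    canonicalChar p K x =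
      Complex.exp (2 * Real.pi * Complex.I * ((Algebra.trace (ZMod p) K x).val : ℂ) / p) := by
  have h := ZMod.stdAddChar_coe (N := p) ((Algebra.trace (ZMod p) K x).val : ℤ)
  rw [Int.cast_natCast, ZMod.natCast_zmod_val] at h
  simpa [canonicalChar] using h

/-- The Weil sum `W_{K,d}(a) = ∑_{x ∈ K} ψ_K (x ^ d + a x)`. -/
noncomputable def weilSum (p : ℕ) [Fact p.Prime] (K : Type*) [Field K] [Fintype K]
    [Algebra (ZMod p) K] (d : ℕ) (a : K) : ℂ :=
  ∑ x : K, canonicalChar p K (x ^ d + a * x)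

/-- The value set `{W_{K,d}(a) : a ∈ Kˣ}`. -/
def weilValueSet (p : ℕ) [Fact p.Prime] (K : Type*) [Field K] [Fintype K]
    [Algebra (ZMod p) K] (d : ℕ) : Set ℂ :=
  Set.range fun a : Kˣ => weilSum p K d (a : K)

/-- `W_{K,d}` is three-valued: its value set has cardinality three. -/
def IsThreeValued (p : ℕ) [Fact p.Prime] (K : Type*) [Field K] [Fintype K]
    [Algebra (ZMod p) K] (d : ℕ) : Prop :=
  (weilValueSet p K d).ncard = 3

/-! The first two power moments force `A = ±p ^ k` with `p ^ k > √q`, and the third gives `A ^ 2 = q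
* N`, where `N` counts the `u` in `K` with `u ^ d + 1 + (-1 - u) ^ d = 0`. Every `u` in a subfield
on which `x ↦ x ^ d` is additive is counted, so it suffices to prove additivity on the subfield of
degree `2 ^ s`; this yields `N ≥ p ^ 2 ^ s`.

Additivity climbs the tower of quadratic extensions. On the prime field it follows from Galois
invariance of the integral Weil sums (`pow_eq_self_of_weilSum_int`). Let `F / L` be a quadratic step
with additivity known on `L`. If the Weil sum over `F` never equals `-|L|`, then `x ↦ Tr (x ^ d) ^
e`, with `e` inverting the power map, meets every `L`-linear form away from the origin. This makes
it additive, and additivity on `F` follows (`add_pow_of_weilSum_ne`).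

The value `-|L| = -√|F|` is excluded by divisibility (`weilSum_ne_neg_pow`): the Weil sums over `K`
are divisible by `p ^ k`, and the Hasse–Davenport relation carries this down to the products of
Gauss sums that make up the Weil sum over `F`. That sum is then divisible by slightly more than
`√|F|`. -/

/-! ### The Hasse–Davenport relation, by the L-function argument. -/

section HasseDavenport

open Polynomial

variable {F : Type*} [Field F]

section PolyChar

variable {R : Type*} [CommRing R] (χ : MulChar F R) (ψ : AddChar F R)

/-- The function `f ↦ χ(N) ψ(T)` on monic polynomials, where `N` and `T` are the product and the
sum of the roots of `f`. -/
noncomputable def polyChar (f : F[X]) : R :=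
  χ ((-1) ^ f.natDegree * f.coeff 0) * ψ (-f.nextCoeff)

theorem polyChar_one : polyChar χ ψ 1 = 1 := by
  simp [polyChar, nextCoeff]

variable {χ ψ} in
theorem polyChar_mul {f g : F[X]} (hf : f.Monic) (hg : g.Monic) :
    polyChar χ ψ (f * g) = polyChar χ ψ f * polyChar χ ψ g := by
  rw [polyChar, hf.natDegree_mul hg, hf.nextCoeff_mul hg, mul_coeff_zero, neg_add,
    AddChar.map_add_eq_mul, pow_add, mul_mul_mul_comm, map_mul, polyChar, polyChar]
  ring

variable {χ ψ} in
theorem polyChar_pow {f : F[X]} (hf : f.Monic) (j : ℕ) :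
    polyChar χ ψ (f ^ j) = polyChar χ ψ f ^ j := by
  induction j with
  | zero => simp [polyChar_one]
  | succ j ih => rw [pow_succ, polyChar_mul (hf.pow j) hf, ih, pow_succ]

-- Passing from `F⟮α⟯` to `K` raises the norm to the power of the relative degree and multiplies the
-- trace by it.
open IntermediateField in
theorem polyChar_minpoly_pow {K : Type*} [Field K] [Finite K] [Algebra F K] (α : K) :
    polyChar χ ψ (minpoly F α) ^ (Module.finrank F⟮α⟯ K) =
      χ (Algebra.norm F α) * ψ (Algebra.trace F K α) := by
  have hα : IsIntegral F α := .of_finite F α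
  have hpb := Algebra.PowerBasis.norm_gen_eq_coeff_zero_minpoly (adjoin.powerBasis hα)
  rw [adjoin.powerBasis_gen, adjoin.powerBasis_dim, minpoly_gen] at hpb
  rw [polyChar, mul_pow, ← map_pow, ← AddChar.map_nsmul_eq_pow, Algebra.norm_eq_norm_adjoin, hpb,
    trace_eq_finrank_mul_minpoly_nextCoeff]
  simp

end PolyChar

variable [Fintype F]

theorem finite_setOf_monic_natDegree_eq (n : ℕ) :
    {f : F[X] | f.Monic ∧ f.natDegree = n}.Finite := by
  have : Finite (degreeLT F (n + 1)) := Finite.of_equiv _ (degreeLTEquiv F (n + 1)).toEquiv.symm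
  refine (Set.toFinite (degreeLT F (n + 1) : Set F[X])).subset ?_
  rintro f ⟨-, hf⟩
  rw [SetLike.mem_coe, mem_degreeLT]
  exact degree_le_natDegree.trans_lt (by rw [hf]; exact_mod_cast n.lt_succ_self)

variable (F) in
/-- The finite set of monic polynomials of degree `n` over a finite field. -/
noncomputable def monicPolys (n : ℕ) : Finset F[X] :=
  (finite_setOf_monic_natDegree_eq n).toFinset

@[simp] theorem mem_monicPolys {n : ℕ} {f : F[X]} :
    f ∈ monicPolys F n ↔ f.Monic ∧ f.natDegree = n := by
  simp [monicPolys]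

open Classical in
variable (F) in
/-- The finite set of monic irreducible polynomials of degree `n` over a finite field. -/
noncomputable def irreduciblePolys (n : ℕ) : Finset F[X] :=
  (monicPolys F n).filter Irreducible

@[simp] theorem mem_irreduciblePolys {n : ℕ} {f : F[X]} :
    f ∈ irreduciblePolys F n ↔ (f.Monic ∧ f.natDegree = n) ∧ Irreducible f := by
  simp [irreduciblePolys]

open Classical in
/-- The degree of a monic polynomial, counted through the irreducible powers dividing it. -/
theorem sum_natDegree_of_pow_dvd {n : ℕ} {f : F[X]} (hf : f ∈ monicPolys F n) :
    ∑ e ∈ Finset.Icc 1 n, ∑ P ∈ irreduciblePolys F e, ∑ j ∈ Finset.Icc 1 n,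
      (if P ^ j ∣ f then e else 0) = n := by
  obtain ⟨hm, hn⟩ := mem_monicPolys.1 hf
  set s := UniqueFactorizationMonoid.normalizedFactors f with hs
  have hprod : s.prod = f := by
    rw [hs, UniqueFactorizationMonoid.prod_normalizedFactors_eq hm.ne_zero, hm.normalize_eq_self]
  have hmem : ∀ P ∈ s, Irreducible P ∧ P.Monic ∧ P ∣ f := fun P hP =>
    ⟨UniqueFactorizationMonoid.irreducible_of_normalized_factor P hP, by
      have h0 := (UniqueFactorizationMonoid.irreducible_of_normalized_factor P hP).ne_zero
      rw [← UniqueFactorizationMonoid.normalize_normalized_factor P hP]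
      exact monic_normalize h0, UniqueFactorizationMonoid.dvd_of_mem_normalizedFactors hP⟩
  have hdeg : ∑ P ∈ s.toFinset, s.count P * P.natDegree = n := by
    rw [← hn]
    conv_rhs => rw [← hprod]
    rw [natDegree_multiset_prod_of_monic _ fun P hP => (hmem P hP).2.1,
      Finset.sum_multiset_map_count]
    rfl
  have hj : ∀ e ∈ Finset.Icc 1 n, ∀ P ∈ irreduciblePolys F e,
      ∑ j ∈ Finset.Icc 1 n, (if P ^ j ∣ f then e else 0) = s.count P * P.natDegree := by
    intro e he P hP
    obtain ⟨⟨hPm, hPe⟩, hPi⟩ := mem_irreduciblePolys.1 hP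
    rw [← Finset.sum_filter, Finset.sum_const, smul_eq_mul, hPe]
    congr 1
    have hdvd : ∀ j, P ^ j ∣ f ↔ j ≤ s.count P := fun j => by
      rw [pow_dvd_iff_le_emultiplicity,
        UniqueFactorizationMonoid.emultiplicity_eq_count_normalizedFactors hPi hm.ne_zero,
        hPm.normalize_eq_self]
      exact Nat.cast_le
    have hle : s.count P ≤ n := by
      have h := natDegree_le_of_dvd ((hdvd _).2 le_rfl) hm.ne_zero
      rw [natDegree_pow, hn, hPe] at h
      exact (Nat.le_mul_of_pos_right _ (Finset.mem_Icc.1 he).1).trans h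
    have : (Finset.Icc 1 n).filter (fun j => P ^ j ∣ f) = Finset.Icc 1 (s.count P) := by
      ext j
      simp only [Finset.mem_filter, Finset.mem_Icc, hdvd]
      omega
    rw [this, Nat.card_Icc, Nat.add_sub_cancel]
  rw [Finset.sum_congr rfl fun e he => Finset.sum_congr rfl (hj e he), ← Finset.sum_biUnion]
  · refine Eq.trans (Eq.symm (Finset.sum_subset ?_ ?_)) hdeg
    · intro P hP
      obtain ⟨hi, hPm, hd⟩ := hmem P (Multiset.mem_toFinset.1 hP)
      refine Finset.mem_biUnion.2 ⟨P.natDegree, Finset.mem_Icc.2 ⟨hi.natDegree_pos, ?_⟩,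
        mem_irreduciblePolys.2 ⟨⟨hPm, rfl⟩, hi⟩⟩
      exact hn ▸ natDegree_le_of_dvd hd hm.ne_zero
    · intro P _ hP
      rw [Multiset.count_eq_zero.2 (by simpa using hP), zero_mul]
  · intro a _ b _ hab
    rw [Function.onFun, Finset.disjoint_left]
    intro P hPa hPb
    exact hab ((mem_irreduciblePolys.1 hPa).1.2.symm.trans (mem_irreduciblePolys.1 hPb).1.2)

variable {R : Type*} [CommRing R] (χ : MulChar F R) (ψ : AddChar F R)

/-- The sum of `polyChar` over all monic polynomials of degree `n`. -/
noncomputable def polyCharSum (n : ℕ) : R := ∑ f ∈ monicPolys F n, polyChar χ ψ f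

/-- The sum of `deg P * polyChar P ^ (n / deg P)` over all monic irreducible polynomials `P` whose
degree divides `n`. -/
noncomputable def irreducibleCharSum (n : ℕ) : R :=
  ∑ x ∈ n.divisorsAntidiagonal, ∑ P ∈ irreduciblePolys F x.1, (x.1 : R) * polyChar χ ψ P ^ x.2

open Classical in
variable {χ ψ} in
theorem sum_filter_dvd_polyChar {n m : ℕ} {g : F[X]} (hg : g ∈ monicPolys F m) :
    ∑ f ∈ (monicPolys F n).filter (g ∣ ·), polyChar χ ψ f =
      if m ≤ n then polyChar χ ψ g * polyCharSum χ ψ (n - m) else 0 := by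
  obtain ⟨hgm, hgd⟩ := mem_monicPolys.1 hg
  split_ifs with h
  · rw [polyCharSum, Finset.mul_sum]
    symm
    refine Finset.sum_bij (fun f _ => g * f) ?_ ?_ ?_ ?_
    · intro f hf
      obtain ⟨hfm, hfd⟩ := mem_monicPolys.1 hf
      simp only [Finset.mem_filter, mem_monicPolys, dvd_mul_right, and_true]
      exact ⟨hgm.mul hfm, by rw [hgm.natDegree_mul hfm]; omega⟩
    · intro a _ b _ hab
      exact mul_left_cancel₀ hgm.ne_zero hab
    · intro f hf
      simp only [Finset.mem_filter, mem_monicPolys] at hf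
      obtain ⟨⟨hfm, hfd⟩, k, rfl⟩ := hf
      have hk := hgm.of_mul_monic_left hfm
      rw [hgm.natDegree_mul hk] at hfd
      exact ⟨k, mem_monicPolys.2 ⟨hk, by omega⟩, rfl⟩
    · intro f hf
      rw [polyChar_mul hgm (mem_monicPolys.1 hf).1]
  · rw [Finset.filter_eq_empty_iff.2, Finset.sum_empty]
    intro f hf hd
    obtain ⟨hfm, hfd⟩ := mem_monicPolys.1 hf
    have := natDegree_le_of_dvd hd hfm.ne_zero
    omega

/-- Newton's identity for the character sums over monic polynomials. -/
theorem nat_mul_polyCharSum (n : ℕ) :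
    (n : R) * polyCharSum χ ψ n =
      ∑ m ∈ Finset.Icc 1 n, irreducibleCharSum χ ψ m * polyCharSum χ ψ (n - m) := by
  classical
  -- This is the logarithmic derivative of the Euler product: split `n = deg f` over the irreducible
  -- powers dividing `f`, then exchange sums.
  have h1 : (n : R) * polyCharSum χ ψ n = ∑ e ∈ Finset.Icc 1 n, ∑ j ∈ Finset.Icc 1 n,
      if e * j ≤ n then (∑ P ∈ irreduciblePolys F e, (e : R) * polyChar χ ψ P ^ j) *
        polyCharSum χ ψ (n - e * j) else 0 := by
    calc (n : R) * polyCharSum χ ψ n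
        = ∑ f ∈ monicPolys F n, ∑ e ∈ Finset.Icc 1 n, ∑ P ∈ irreduciblePolys F e,
            ∑ j ∈ Finset.Icc 1 n, if P ^ j ∣ f then (e : R) * polyChar χ ψ f else 0 := by
          rw [polyCharSum, Finset.mul_sum]
          refine Finset.sum_congr rfl fun f hf => ?_
          conv_lhs => rw [← sum_natDegree_of_pow_dvd hf]
          push_cast
          simp only [Finset.sum_mul, ite_mul, zero_mul]
      _ = ∑ e ∈ Finset.Icc 1 n, ∑ P ∈ irreduciblePolys F e, ∑ j ∈ Finset.Icc 1 n,
            (e : R) * ∑ f ∈ (monicPolys F n).filter (P ^ j ∣ ·), polyChar χ ψ f := by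
          rw [Finset.sum_comm]
          refine Finset.sum_congr rfl fun e _ => ?_
          rw [Finset.sum_comm]
          refine Finset.sum_congr rfl fun P _ => ?_
          rw [Finset.sum_comm]
          refine Finset.sum_congr rfl fun j _ => ?_
          rw [Finset.mul_sum, Finset.sum_filter]
      _ = _ := by
          refine Finset.sum_congr rfl fun e _ => ?_
          rw [Finset.sum_comm]
          refine Finset.sum_congr rfl fun j _ => ?_
          have : ∀ P ∈ irreduciblePolys F e,
              (e : R) * ∑ f ∈ (monicPolys F n).filter (P ^ j ∣ ·), polyChar χ ψ f =
              if e * j ≤ n then (e : R) * polyChar χ ψ P ^ j * polyCharSum χ ψ (n - e * j)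
              else 0 := by
            intro P hP
            obtain ⟨⟨hPm, hPe⟩, -⟩ := mem_irreduciblePolys.1 hP
            rw [sum_filter_dvd_polyChar (m := e * j) (mem_monicPolys.2
              ⟨hPm.pow j, by rw [natDegree_pow, hPe, mul_comm]⟩), polyChar_pow hPm]
            split_ifs <;> ring
          rw [Finset.sum_congr rfl this]
          split_ifs
          · rw [Finset.sum_mul]
          · simp
  -- Pairs `(e, j)` are regrouped by `m = e * j`.
  rw [h1, ← Finset.sum_product', ← Finset.sum_filter,
    ← Finset.sum_fiberwise_of_maps_to (t := Finset.Icc 1 n) (g := fun x => x.1 * x.2)]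
  · refine Finset.sum_congr rfl fun m hm => ?_
    rw [irreducibleCharSum, Finset.sum_mul]
    have : (((Finset.Icc 1 n ×ˢ Finset.Icc 1 n).filter fun x => x.1 * x.2 ≤ n).filter
        fun x => x.1 * x.2 = m) = m.divisorsAntidiagonal := by
      ext ⟨a, b⟩
      simp only [Finset.mem_filter, Finset.mem_product, Finset.mem_Icc,
        Nat.mem_divisorsAntidiagonal] at hm ⊢
      constructor
      · rintro ⟨-, h⟩
        exact ⟨h, by omega⟩
      · rintro ⟨rfl, h⟩
        have ha : 0 < a := Nat.pos_of_ne_zero fun h0 => h (by simp [h0])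
        have hb : 0 < b := Nat.pos_of_ne_zero fun h0 => h (by simp [h0])
        exact ⟨⟨⟨⟨ha, (Nat.le_mul_of_pos_right a hb).trans hm.2⟩, hb,
          (Nat.le_mul_of_pos_left b ha).trans hm.2⟩, hm.2⟩, rfl⟩
    rw [this]
    refine Finset.sum_congr rfl fun x hx => ?_
    rw [(Nat.mem_divisorsAntidiagonal.1 hx).1]
  · rintro ⟨a, b⟩ hx
    simp only [Finset.mem_filter, Finset.mem_product, Finset.mem_Icc] at hx ⊢
    exact ⟨Nat.mul_pos hx.1.1.1 hx.1.2.1, hx.2⟩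

theorem polyCharSum_zero : polyCharSum χ ψ 0 = 1 := by
  have : monicPolys F 0 = {1} := by
    ext f
    simp only [mem_monicPolys, Finset.mem_singleton]
    exact ⟨fun h => h.1.natDegree_eq_zero.1 h.2, by rintro rfl; simp⟩
  rw [polyCharSum, this, Finset.sum_singleton, polyChar_one]

theorem polyCharSum_one : polyCharSum χ ψ 1 = gaussSum χ ψ := by
  rw [polyCharSum, gaussSum]
  symm
  refine Finset.sum_bij (fun a _ => X - C a) ?_ ?_ ?_ ?_
  · intro a _
    simp [monic_X_sub_C]
  · intro a _ b _ h
    simpa using h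
  · intro f hf
    obtain ⟨hm, hd⟩ := mem_monicPolys.1 hf
    refine ⟨-f.coeff 0, Finset.mem_univ _, ?_⟩
    conv_rhs => rw [hm.eq_X_add_C hd]
    simp
  · intro a _
    simp [polyChar]

-- In degree at least two the constant and next-to-leading coefficients are distinct. Scaling the
-- constant one by `u` with `χ u ≠ 1` therefore permutes the monic polynomials and multiplies the
-- sum by `χ u`.
variable {χ} in
theorem polyCharSum_eq_zero [IsDomain R] (hχ : χ ≠ 1) {n : ℕ} (hn : 2 ≤ n) :
    polyCharSum χ ψ n = 0 := by
  obtain ⟨u, hu⟩ := MulChar.ne_one_iff.1 hχ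
  have hdeg : ∀ (v : F) {f : F[X]}, f ∈ monicPolys F n →
      (f + C v) ∈ monicPolys F n ∧ (f + C v).nextCoeff = f.nextCoeff := by
    intro v f hf
    obtain ⟨hm, hd⟩ := mem_monicPolys.1 hf
    have hlt : (C v).degree < f.degree :=
      degree_C_le.trans_lt (by rw [degree_eq_natDegree hm.ne_zero, hd]; exact_mod_cast by omega)
    have hd' : (f + C v).natDegree = n := by rw [natDegree_add_C, hd]
    refine ⟨mem_monicPolys.2 ⟨hm.add_of_left hlt, hd'⟩, ?_⟩
    rw [nextCoeff_of_natDegree_pos (by omega), nextCoeff_of_natDegree_pos (by omega), hd', hd,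
      coeff_add, coeff_C, if_neg (by omega), add_zero]
  have h : polyCharSum χ ψ n = χ u * polyCharSum χ ψ n := by
    conv_rhs => rw [polyCharSum, Finset.mul_sum]
    rw [polyCharSum]
    symm
    refine Finset.sum_bij' (fun f _ => f + C ((u - 1) * f.coeff 0))
      (fun f _ => f + C (((u⁻¹ : Fˣ) - 1) * f.coeff 0)) (fun f hf => (hdeg _ hf).1)
      (fun f hf => (hdeg _ hf).1) ?_ ?_ ?_
    · intro f _
      rw [add_assoc, ← C_add]
      convert add_zero f
      rw [coeff_add, coeff_C_zero, C_eq_zero]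
      linear_combination f.coeff 0 * u.inv_mul
    · intro f _
      rw [add_assoc, ← C_add]
      convert add_zero f
      rw [coeff_add, coeff_C_zero, C_eq_zero]
      linear_combination f.coeff 0 * u.mul_inv
    · intro f hf
      rw [polyChar, polyChar, (hdeg _ hf).2, natDegree_add_C, coeff_add, coeff_C_zero, ← mul_assoc,
        ← map_mul]
      congr 2
      ring
  have h' : (χ u - 1) * polyCharSum χ ψ n = 0 := by linear_combination -h
  exact (mul_eq_zero.1 h').resolve_left (sub_ne_zero.2 hu)

-- The L-function is `1 + g t` with `g` the Gauss sum, so Newton's identity collapses to a recursion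
-- with ratio `-g`.
variable {χ} in
theorem irreducibleCharSum_succ [IsDomain R] (hχ : χ ≠ 1) (n : ℕ) :
    irreducibleCharSum χ ψ (n + 1) = (-1) ^ n * gaussSum χ ψ ^ (n + 1) := by
  induction n with
  | zero =>
    have h := nat_mul_polyCharSum χ ψ 1
    rw [polyCharSum_one] at h
    simpa [polyCharSum_zero] using h.symm
  | succ n ih =>
    have h := nat_mul_polyCharSum χ ψ (n + 2)
    rw [polyCharSum_eq_zero ψ hχ (by omega), mul_zero,
      Finset.sum_eq_add_of_mem (n + 1) (n + 2) (by simp) (by simp) (by omega)] at h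
    · rw [show n + 2 - (n + 1) = 1 by omega, Nat.sub_self, polyCharSum_one, polyCharSum_zero, ih]
        at h
      linear_combination -h
    · intro m hm hne
      rw [polyCharSum_eq_zero ψ hχ, mul_zero]
      have := Finset.mem_Icc.1 hm
      omega

variable (K : Type*) [Field K] [Fintype K] [Algebra F K]

theorem card_filter_minpoly_eq [DecidableEq F[X]] {P : F[X]} (hP : Irreducible P) (hm : P.Monic)
    (hd : P.natDegree ∣ Module.finrank F K) :
    (Finset.univ.filter fun α : K => minpoly F α = P).card = P.natDegree := by
  have hsep : P.Separable := PerfectField.separable_of_irreducible hP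
  have hcard : Nat.card F ^ Module.finrank F K = Fintype.card K := by
    rw [Nat.card_eq_fintype_card, Module.card_eq_pow_finrank (K := F) (V := K)]
  have hdvd : P ∣ X ^ Fintype.card K - X := by
    rw [← hcard]
    exact hP.natDegree_dvd_iff_dvd_X_pow_card_pow_sub_X.1 hd
  have hne : (X ^ Fintype.card K - X : K[X]) ≠ 0 :=
    FiniteField.X_pow_card_sub_X_ne_zero K Fintype.one_lt_card
  have hspl : (P.map (algebraMap F K)).Splits := by
    refine Splits.of_dvd (g := X ^ Fintype.card K - X) ?_ hne ?_
    · rw [splits_iff_card_roots, FiniteField.roots_X_pow_card_sub_X,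
        FiniteField.X_pow_card_sub_X_natDegree_eq K Fintype.one_lt_card]
      rfl
    · simpa using Polynomial.map_dvd (algebraMap F K) hdvd
  rw [← card_rootSet_eq_natDegree hsep hspl, ← Set.toFinset_card]
  congr 1
  ext α
  simp only [Finset.mem_filter, Finset.mem_univ, true_and, Set.mem_toFinset, mem_rootSet]
  constructor
  · rintro rfl
    exact ⟨hP.ne_zero, minpoly.aeval F α⟩
  · rintro ⟨-, h⟩
    exact (minpoly.eq_of_irreducible_of_monic hP h hm).symm

/-- The Hasse–Davenport lifting relation. -/
theorem hasseDavenport [IsDomain R] {χ : MulChar F R} (hχ : χ ≠ 1) (ψ : AddChar F R) :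
    ∑ α : K, χ (Algebra.norm F α) * ψ (Algebra.trace F K α) =
      (-1) ^ (Module.finrank F K - 1) * gaussSum χ ψ ^ Module.finrank F K := by
  classical
  have hpos : 0 < Module.finrank F K := Module.finrank_pos
  obtain ⟨n, hn⟩ := Nat.exists_eq_add_of_lt hpos
  rw [zero_add] at hn
  rw [hn, Nat.add_sub_cancel, ← irreducibleCharSum_succ ψ hχ n, ← hn, irreducibleCharSum]
  have hdeg : ∀ α : K, (minpoly F α).natDegree * Module.finrank (IntermediateField.adjoin F {α}) K =
      Module.finrank F K := fun α => by
    rw [← IntermediateField.adjoin.finrank (.of_finite F α), Module.finrank_mul_finrank]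
  rw [← Finset.sum_fiberwise_of_maps_to (t := (Module.finrank F K).divisorsAntidiagonal)
    (g := fun α : K => ((minpoly F α).natDegree,
      Module.finrank (IntermediateField.adjoin F {α}) K))]
  · refine Finset.sum_congr rfl fun x hx => ?_
    obtain ⟨hx1, hx0⟩ := Nat.mem_divisorsAntidiagonal.1 hx
    rw [← Finset.sum_fiberwise_of_maps_to (t := irreduciblePolys F x.1) (g := minpoly F)]
    · refine Finset.sum_congr rfl fun P hP => ?_
      obtain ⟨⟨hPm, hPd⟩, hPi⟩ := mem_irreduciblePolys.1 hP
      have hset : ((Finset.univ.filter fun α : K => ((minpoly F α).natDegree,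
          Module.finrank (IntermediateField.adjoin F {α}) K) = x).filter fun α => minpoly F α = P) =
          Finset.univ.filter fun α : K => minpoly F α = P := by
        ext α
        simp only [Finset.mem_filter, Finset.mem_univ, true_and, and_iff_right_iff_imp]
        rintro rfl
        have h := hdeg α
        rw [← hx1, hPd] at h
        refine Prod.ext hPd (Nat.eq_of_mul_eq_mul_left (Nat.pos_of_ne_zero fun h0 => ?_) h)
        simp [h0] at hx1
        omega
      have hval : ∀ α ∈ (Finset.univ.filter fun α : K => ((minpoly F α).natDegree,
          Module.finrank (IntermediateField.adjoin F {α}) K) = x).filter fun α => minpoly F α = P,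
          χ (Algebra.norm F α) * ψ (Algebra.trace F K α) = polyChar χ ψ P ^ x.2 := by
        intro α hα
        simp only [Finset.mem_filter, Finset.mem_univ, true_and] at hα
        rw [← polyChar_minpoly_pow, hα.2, ← hα.1]
      rw [Finset.sum_congr rfl hval, Finset.sum_const, hset,
        card_filter_minpoly_eq K hPi hPm (hPd ▸ ⟨_, hx1.symm⟩), hPd, nsmul_eq_mul]
    · intro α hα
      simp only [Finset.mem_filter, Finset.mem_univ, true_and] at hα
      exact mem_irreduciblePolys.2 ⟨⟨minpoly.monic (.of_finite F α), by rw [← hα]⟩,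
        minpoly.irreducible (.of_finite F α)⟩
  · intro α _
    exact Nat.mem_divisorsAntidiagonal.2 ⟨hdeg α, hpos.ne'⟩

end HasseDavenport

/-! ### Fourier inversion and the canonical character. -/

section WeilMoments

theorem AddChar.isIntegral_apply {G : Type*} [AddGroup G] [Finite G] (ψ : AddChar G ℂ) (x : G) :
    IsIntegral ℤ (ψ x) := by
  refine IsIntegral.of_pow (n := addOrderOf x) (addOrderOf_pos x) ?_
  rw [← AddChar.map_nsmul_eq_pow, addOrderOf_nsmul_eq_zero, AddChar.map_zero_eq_one]
  exact isIntegral_one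

/-- The Fourier transform with respect to a primitive character is injective. -/
theorem AddChar.IsPrimitive.eq_of_sum_eq {K : Type*} [Field K] [Fintype K] {ψ : AddChar K ℂ}
    (hψ : ψ.IsPrimitive) {g h : K → ℂ}
    (hgh : ∀ a, ∑ x, g x * ψ (a * x) = ∑ x, h x * ψ (a * x)) : g = h := by
  classical
  have key : ∀ (u : K → ℂ) (y : K),
      ∑ a, ψ (a * -y) * ∑ x, u x * ψ (a * x) = Fintype.card K * u y := by
    intro u y
    have : ∀ a, ψ (a * -y) * ∑ x, u x * ψ (a * x) = ∑ x, u x * ψ (a * (x - y)) := by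
      intro a
      rw [Finset.mul_sum]
      refine Finset.sum_congr rfl fun x _ => ?_
      rw [sub_eq_add_neg, mul_add, AddChar.map_add_eq_mul]
      ring
    simp_rw [this]
    rw [Finset.sum_comm]
    simp_rw [← Finset.mul_sum, AddChar.sum_mulShift _ hψ, sub_eq_zero]
    simp [mul_comm]
  funext y
  have h1 := key g y
  simp_rw [hgh] at h1
  rw [key h y] at h1
  exact mul_left_cancel₀ (Nat.cast_ne_zero.2 Fintype.card_ne_zero) h1.symm

variable (p : ℕ) [Fact p.Prime] (K : Type*) [Field K] [Algebra (ZMod p) K]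

theorem canonicalChar_apply (x : K) :
    canonicalChar p K x = ZMod.stdAddChar (Algebra.trace (ZMod p) K x) := rfl

variable [Fintype K]

theorem canonicalChar_isPrimitive : (canonicalChar p K).IsPrimitive := by
  refine AddChar.IsPrimitive.of_ne_one ?_
  obtain ⟨x, hx⟩ := Algebra.trace_surjective (ZMod p) K 1
  refine (AddChar.ne_one_iff).2 ⟨x, ?_⟩
  rw [canonicalChar_apply, hx, ← AddChar.map_zero_eq_one (ZMod.stdAddChar (N := p))]
  exact fun h => one_ne_zero (ZMod.injective_stdAddChar h)

variable {K} {d : ℕ}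

theorem weilSum_eq (a : K) :
    weilSum p K d a = ∑ x, canonicalChar p K (x ^ d) * canonicalChar p K (a * x) := by
  simp [weilSum, AddChar.map_add_eq_mul]

theorem isIntegral_weilSum (a : K) : IsIntegral ℤ (weilSum p K d a) :=
  IsIntegral.sum _ fun _ _ => AddChar.isIntegral_apply _ _

end WeilMoments

/-! ### Invertible power maps. -/

section PowInverse

variable {K : Type*} [Field K] {d e : ℕ}

theorem ne_zero_of_pow_pow (hde : ∀ x : K, (x ^ d) ^ e = x) : d ≠ 0 := by
  rintro rfl
  simpa using hde 0

theorem ne_zero_of_pow_pow' (hde : ∀ x : K, (x ^ d) ^ e = x) : e ≠ 0 := by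
  rintro rfl
  simpa using hde 0

theorem pow_pow_comm (hde : ∀ x : K, (x ^ d) ^ e = x) (x : K) : (x ^ e) ^ d = x := by
  rw [pow_right_comm, hde]

theorem pow_bijective (hde : ∀ x : K, (x ^ d) ^ e = x) :
    Function.Bijective fun x : K => x ^ d :=
  Function.bijective_iff_has_inverse.2 ⟨fun x => x ^ e, hde, pow_pow_comm hde⟩

/-- An even `d` sends `-1` to `1`, so invertibility forces `-1 = 1`. -/
theorem neg_pow_of_pow_pow (hde : ∀ x : K, (x ^ d) ^ e = x) (x : K) : (-x) ^ d = -x ^ d := by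
  rcases Nat.even_or_odd d with h | h
  · have h1 : (-1 : K) = 1 := by
      have := hde (-1)
      rwa [h.neg_one_pow, one_pow, eq_comm] at this
    rw [h.neg_pow, ← neg_one_mul (x ^ d), h1, one_mul]
  · exact h.neg_pow x

end PowInverse

/-! ### Power moments of the Weil sums. -/

section WeilMoments

variable (p : ℕ) [Fact p.Prime] {K : Type*} [Field K] [Fintype K] [Algebra (ZMod p) K] {d e : ℕ}

theorem weilSum_zero (hde : ∀ x : K, (x ^ d) ^ e = x) : weilSum p K d 0 = 0 := by
  classical
  simp only [weilSum, zero_mul, add_zero]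
  rw [(pow_bijective hde).sum_comp fun x => canonicalChar p K x]
  have h := AddChar.sum_mulShift (1 : K) (canonicalChar_isPrimitive p K)
  simpa using h

theorem sum_weilSum_mul (g : K → ℂ) :
    ∑ a, weilSum p K d a * g a =
      ∑ x, canonicalChar p K (x ^ d) * ∑ a, g a * canonicalChar p K (a * x) := by
  simp_rw [weilSum_eq, Finset.sum_mul, Finset.mul_sum]
  rw [Finset.sum_comm]
  exact Finset.sum_congr rfl fun x _ => Finset.sum_congr rfl fun a _ => by ring

theorem sum_weilSum (hde : ∀ x : K, (x ^ d) ^ e = x) :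
    ∑ a : K, weilSum p K d a = Fintype.card K := by
  classical
  have h := sum_weilSum_mul p (d := d) fun _ : K => 1
  simp only [mul_one, one_mul] at h
  rw [h]
  simp_rw [AddChar.sum_mulShift _ (canonicalChar_isPrimitive p K)]
  simp [ne_zero_of_pow_pow hde]

theorem sum_weilSum_sq (hde : ∀ x : K, (x ^ d) ^ e = x) :
    ∑ a : K, weilSum p K d a ^ 2 = (Fintype.card K : ℂ) ^ 2 := by
  classical
  have h : ∀ a : K, weilSum p K d a ^ 2 = ∑ x, ∑ y, canonicalChar p K (x ^ d + y ^ d) *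
      canonicalChar p K (a * (x + y)) := by
    intro a
    rw [sq, weilSum_eq, Finset.sum_mul_sum]
    refine Finset.sum_congr rfl fun x _ => Finset.sum_congr rfl fun y _ => ?_
    rw [mul_add, AddChar.map_add_eq_mul, AddChar.map_add_eq_mul]
    ring
  simp_rw [h]
  rw [Finset.sum_comm]
  have h2 : ∀ x : K, ∑ a : K, ∑ y, canonicalChar p K (x ^ d + y ^ d) *
      canonicalChar p K (a * (x + y)) = Fintype.card K := by
    intro x
    rw [Finset.sum_comm]
    simp_rw [← Finset.mul_sum, AddChar.sum_mulShift _ (canonicalChar_isPrimitive p K)]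
    rw [Finset.sum_eq_single (-x)]
    · simp [neg_pow_of_pow_pow hde]
    · intro y _ hy
      rw [if_neg fun h => hy (eq_neg_of_add_eq_zero_right h), Nat.cast_zero, mul_zero]
    · simp
  simp [h2, sq]

open Classical in
/-- The third power moment of the Weil sums. -/
theorem sum_weilSum_pow_three (hde : ∀ x : K, (x ^ d) ^ e = x) :
    ∑ a : K, weilSum p K d a ^ 3 = (Fintype.card K : ℂ) ^ 2 *
      (Finset.univ.filter fun u : K => u ^ d + 1 + (-1 - u) ^ d = 0).card := by
  have hd := ne_zero_of_pow_pow hde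
  have h : ∀ a : K, weilSum p K d a ^ 3 = ∑ y, ∑ x, ∑ z,
      canonicalChar p K (x ^ d + y ^ d + z ^ d) * canonicalChar p K (a * (x + y + z)) := by
    intro a
    rw [pow_three, weilSum_eq, Finset.sum_mul_sum, Finset.sum_mul_sum]
    refine Finset.sum_congr rfl fun x _ => ?_
    simp_rw [Finset.mul_sum]
    refine Finset.sum_congr rfl fun y _ => Finset.sum_congr rfl fun z _ => ?_
    simp only [mul_add, AddChar.map_add_eq_mul]
    ring
  have h1 : ∀ x y : K, ∑ a : K, ∑ z,
      canonicalChar p K (x ^ d + y ^ d + z ^ d) * canonicalChar p K (a * (x + y + z)) =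
      Fintype.card K * canonicalChar p K (x ^ d + y ^ d + (-(x + y)) ^ d) := by
    intro x y
    rw [Finset.sum_comm]
    simp_rw [← Finset.mul_sum, AddChar.sum_mulShift _ (canonicalChar_isPrimitive p K)]
    rw [Finset.sum_eq_single (-(x + y))]
    · simp [mul_comm]
    · intro z _ hz
      rw [if_neg fun h => hz (eq_neg_of_add_eq_zero_right h), Nat.cast_zero, mul_zero]
    · simp
  have h2 : ∑ a : K, weilSum p K d a ^ 3 = Fintype.card K * ∑ y, ∑ x,
      canonicalChar p K (x ^ d + y ^ d + (-(x + y)) ^ d) := by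
    simp_rw [h, Finset.mul_sum, ← h1]
    rw [Finset.sum_comm]
    refine Finset.sum_congr rfl fun y _ => ?_
    rw [Finset.sum_comm]
  -- Substituting `x = u * y` pulls out `y ^ d`, which runs over `K` with `y`; the sum over `y` then
  -- detects the roots `u`.
  have h3 : ∀ y : K, y ≠ 0 → ∑ x, canonicalChar p K (x ^ d + y ^ d + (-(x + y)) ^ d) =
      ∑ u : K, canonicalChar p K (y ^ d * (u ^ d + 1 + (-1 - u) ^ d)) := by
    intro y hy
    rw [← (mulRight_bijective₀ y hy).sum_comp]
    refine Finset.sum_congr rfl fun u _ => ?_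
    congr 1
    rw [show -(u * y + y) = y * (-1 - u) by ring, mul_pow, mul_pow]
    ring
  have h4 : ∑ x : K, canonicalChar p K (x ^ d + 0 ^ d + (-(x + 0)) ^ d) = Fintype.card K := by
    simp [neg_pow_of_pow_pow hde, hd]
  have h5 : ∑ y ∈ Finset.univ.erase (0 : K), ∑ u : K,
      canonicalChar p K (y ^ d * (u ^ d + 1 + (-1 - u) ^ d)) = ∑ u : K,
      ((if u ^ d + 1 + (-1 - u) ^ d = 0 then (Fintype.card K : ℂ) else 0) - 1) := by
    rw [Finset.sum_comm]
    refine Finset.sum_congr rfl fun u _ => ?_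
    rw [Finset.sum_erase_eq_sub (Finset.mem_univ _),
      (pow_bijective hde).sum_comp fun y => canonicalChar p K (y * (u ^ d + 1 + (-1 - u) ^ d)),
      AddChar.sum_mulShift _ (canonicalChar_isPrimitive p K)]
    simp [hd]
  rw [h2, ← Finset.add_sum_erase _ _ (Finset.mem_univ (0 : K)), h4,
    Finset.sum_congr rfl fun y hy => h3 y (Finset.ne_of_mem_erase hy), h5, Finset.sum_sub_distrib,
    ← Finset.sum_filter, Finset.sum_const, Finset.sum_const, Finset.card_univ]
  simp only [nsmul_eq_mul]
  ring

/-- The shape of the values of a symmetric Weil sum: up to sign, the nonzero value is a power of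
`p` exceeding `√q`. -/
theorem exists_eq_pow_of_weilSum_eq (hde : ∀ x : K, (x ^ d) ^ e = x) {A : ℂ}
    (hA : ∀ a : K, weilSum p K d a = 0 ∨ weilSum p K d a = A ∨ weilSum p K d a = -A)
    (hA' : IsIntegral ℤ A) :
    ∃ k : ℕ, Module.finrank (ZMod p) K < 2 * k ∧ (A = p ^ k ∨ A = -p ^ k) := by
  have hp : p.Prime := Fact.out
  have hq : Fintype.card K = p ^ Module.finrank (ZMod p) K :=
    (FiniteField.pow_finrank_eq_card p K).symm
  set n := Module.finrank (ZMod p) K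
  have hq0 : (Fintype.card K : ℂ) ≠ 0 := Nat.cast_ne_zero.2 Fintype.card_ne_zero
  have hε : ∀ a : K, ∃ ε : ℤ, weilSum p K d a = A * ε ∧ ε ^ 2 ≤ 1 ∧ (a = 0 → ε = 0) := by
    intro a
    by_cases ha : a = 0
    · exact ⟨0, by simp [ha, weilSum_zero p hde]⟩
    · rcases hA a with h | h | h
      · exact ⟨0, by simp [h]⟩
      · exact ⟨1, by simp [h, ha]⟩
      · exact ⟨-1, by simp [h, ha]⟩
  choose ε h1 h2 h3 using hε
  have hs1 : A * ((∑ a, ε a : ℤ) : ℂ) = Fintype.card K := by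
    rw [← sum_weilSum p hde, Int.cast_sum, Finset.mul_sum]
    exact Finset.sum_congr rfl fun a _ => (h1 a).symm
  have hs2 : A ^ 2 * ((∑ a, ε a ^ 2 : ℤ) : ℂ) = (Fintype.card K : ℂ) ^ 2 := by
    rw [← sum_weilSum_sq p hde, Int.cast_sum, Finset.mul_sum]
    refine Finset.sum_congr rfl fun a _ => ?_
    rw [h1 a]
    push_cast
    ring
  -- Strict because `ε 0 = 0`; this is the source of the strict bound `A ^ 2 > q`.
  have hlt : ∑ a, ε a ^ 2 < Fintype.card K := by
    calc ∑ a, ε a ^ 2 < ∑ _a : K, (1 : ℤ) :=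
          Finset.sum_lt_sum (fun a _ => h2 a) ⟨0, Finset.mem_univ _, by simp [h3 0 rfl]⟩
      _ = Fintype.card K := by simp
  have hN : ((∑ a, ε a : ℤ) : ℂ) ≠ 0 := fun h => hq0 (by rw [← hs1, h, mul_zero])
  -- The first moment makes `A` rational; being integral, it is an integer dividing `q`.
  obtain ⟨B, hB⟩ : ∃ B : ℤ, (B : ℂ) = A := by
    have hr : A = algebraMap ℚ ℂ ((Fintype.card K : ℚ) / ((∑ a, ε a : ℤ) : ℚ)) := by
      rw [eq_ratCast, Rat.cast_div, Rat.cast_natCast, Rat.cast_intCast, eq_div_iff hN, hs1]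
    rw [hr, isIntegral_algebraMap_iff (algebraMap ℚ ℂ).injective] at hA'
    obtain ⟨B, hB⟩ := IsIntegrallyClosed.isIntegral_iff.1 hA'
    refine ⟨B, ?_⟩
    rw [hr, ← hB]
    simp
  rw [← hB] at hs1 hs2 ⊢
  norm_cast at hs1 hs2
  have hdvd : B.natAbs ∣ p ^ n := by
    rw [← hq]
    exact Int.natAbs_dvd_natAbs.2 (Dvd.intro _ hs1)
  obtain ⟨k, -, hk⟩ := (Nat.dvd_prime_pow hp).1 hdvd
  refine ⟨k, ?_, ?_⟩
  · have hB2 : B ^ 2 = (p : ℤ) ^ (2 * k) := by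
      rw [← Int.natAbs_sq, hk, pow_mul', Nat.cast_pow]
    have hBpos : (0 : ℤ) < B ^ 2 := by
      rw [hB2]
      exact pow_pos (by exact_mod_cast hp.pos) _
    have hqpos : (0 : ℤ) < Fintype.card K := by exact_mod_cast Fintype.card_pos
    have hlt2 : (Fintype.card K : ℤ) < B ^ 2 := by
      have hs2' : B ^ 2 * ∑ a, ε a ^ 2 = (Fintype.card K : ℤ) ^ 2 := by exact_mod_cast hs2
      nlinarith
    rw [hB2, hq] at hlt2
    exact (Nat.pow_lt_pow_iff_right hp.one_lt).1 (by exact_mod_cast hlt2)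
  · rcases Int.natAbs_eq B with h | h
    · left; rw [h, hk]; norm_cast
    · right; rw [h, hk]; push_cast; rfl

/-- For a symmetric Weil sum the square of the nonzero value is read off from the third moment. -/
theorem card_mul_card_le_norm_sq (hde : ∀ x : K, (x ^ d) ^ e = x) {A : ℂ}
    (hA : ∀ a : K, weilSum p K d a = 0 ∨ weilSum p K d a = A ∨ weilSum p K d a = -A)
    {F : Type*} [Field F] [Fintype F] (f : F →+* K)
    (hF : ∀ x y : F, (x + y) ^ d = x ^ d + y ^ d) :
    (Fintype.card F : ℝ) * Fintype.card K ≤ ‖A‖ ^ 2 := by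
  classical
  have hq0 : (Fintype.card K : ℂ) ≠ 0 := Nat.cast_ne_zero.2 Fintype.card_ne_zero
  -- Each value satisfies `W ^ 3 = A ^ 2 * W`, so the third moment is `A ^ 2` times the first.
  have h3 : A ^ 2 * Fintype.card K = (Fintype.card K : ℂ) ^ 2 *
      (Finset.univ.filter fun u : K => u ^ d + 1 + (-1 - u) ^ d = 0).card := by
    rw [← sum_weilSum_pow_three p hde, ← sum_weilSum p hde, Finset.mul_sum]
    refine Finset.sum_congr rfl fun a _ => ?_
    rcases hA a with h | h | h <;> rw [h] <;> ring
  have h4 : A ^ 2 = (Fintype.card K : ℂ) *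
      (Finset.univ.filter fun u : K => u ^ d + 1 + (-1 - u) ^ d = 0).card :=
    mul_right_cancel₀ hq0 (by rw [h3]; ring)
  have h5 : Fintype.card F ≤
      (Finset.univ.filter fun u : K => u ^ d + 1 + (-1 - u) ^ d = 0).card := by
    rw [← Finset.card_univ]
    refine Finset.card_le_card_of_injOn f (fun u _ => ?_) f.injective.injOn
    have h : (-1 - f u) ^ d = -(f u ^ d + 1) := by
      rw [show -1 - f u = -f (u + 1) by rw [map_add, map_one]; ring, neg_pow_of_pow_pow hde,
        ← map_pow, hF, map_add, map_pow, one_pow, map_one]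
    simp [h]
  rw [← norm_pow, h4, norm_mul, Complex.norm_natCast, Complex.norm_natCast, mul_comm]
  gcongr

end WeilMoments

/-! ### Galois invariance and the prime field. -/

section PrimeField

variable (p : ℕ) [Fact p.Prime] {K : Type*} [Field K] [Algebra (ZMod p) K]

open Polynomial in
/-- A character sum with an integral value is invariant under the Galois action `ψ ↦ ψ ^ c`. -/
theorem sum_canonicalChar_pow_eq {ι : Type*} [Fintype ι] (f : ι → K) {w : ℤ}
    (hw : ∑ x, canonicalChar p K (f x) = w) {c : ℕ} (hc : c.Coprime p) :
    ∑ x, canonicalChar p K (f x) ^ c = w := by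
  have hp : p.Prime := Fact.out
  set ζ : ℂ := Complex.exp (2 * Real.pi * Complex.I / p)
  have hζ : IsPrimitiveRoot ζ p := Complex.isPrimitiveRoot_exp p hp.ne_zero
  have hval : ∀ x : K, canonicalChar p K x = ζ ^ (Algebra.trace (ZMod p) K x).val := by
    intro x
    rw [canonicalChar_eq_exp, ← Complex.exp_nat_mul]
    congr 1
    ring
  set P : ℤ[X] := ∑ x, X ^ (Algebra.trace (ZMod p) K (f x)).val - C w with hP
  have haev : ∀ z : ℂ, aeval z P = ∑ x, z ^ (Algebra.trace (ZMod p) K (f x)).val - w := by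
    intro z
    simp [hP]
  have h0 : aeval ζ P = 0 := by
    rw [haev, ← hw, sub_eq_zero]
    exact Finset.sum_congr rfl fun x _ => (hval _).symm
  -- `ζ` and `ζ ^ c` share a minimal polynomial, so the relation `P` transfers.
  have hdvd := minpoly.isIntegrallyClosed_dvd (hζ.isIntegral hp.pos) h0
  rw [hζ.minpoly_eq_pow_coprime hc] at hdvd
  have h1 : aeval (ζ ^ c) P = 0 := by
    obtain ⟨R, hR⟩ := hdvd
    rw [hR, map_mul, minpoly.aeval, zero_mul]
  rw [haev, sub_eq_zero] at h1
  rw [← h1]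
  refine Finset.sum_congr rfl fun x _ => ?_
  rw [hval, ← pow_mul, ← pow_mul, mul_comm]

variable [Fintype K] {d e : ℕ}

/-- Invariance under `ψ ↦ ψ ^ c`, after replacing `x` by `x / c`, says that `ψ (c * (x / c) ^ d)`
and `ψ (x ^ d)` have the same Fourier transform. Hence `c * c⁻¹ ^ d = 1`. -/
theorem natCast_pow_eq_of_weilSum_int (hde : ∀ x : K, (x ^ d) ^ e = x)
    (hW : ∀ a : K, ∃ w : ℤ, weilSum p K d a = w) {c : ℕ} (hc : c.Coprime p) :
    (c : K) ^ d = c := by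
  have : CharP K p := charP_of_injective_algebraMap (algebraMap (ZMod p) K).injective p
  have hp : p.Prime := Fact.out
  have hc0 : (c : K) ≠ 0 := by
    rw [Ne, CharP.cast_eq_zero_iff K p]
    exact fun h => hp.one_lt.ne' (Nat.Coprime.eq_one_of_dvd hc.symm h)
  have hfun := (canonicalChar_isPrimitive p K).eq_of_sum_eq
    (g := fun x => canonicalChar p K (c * ((c : K)⁻¹ * x) ^ d))
    (h := fun x => canonicalChar p K (x ^ d)) fun a => by
      obtain ⟨w, hw⟩ := hW a
      rw [← weilSum_eq, hw, ← sum_canonicalChar_pow_eq p _ hw hc,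
        ← (mulLeft_bijective₀ (c : K) hc0).sum_comp]
      refine Finset.sum_congr rfl fun x _ => ?_
      rw [← AddChar.map_nsmul_eq_pow, ← AddChar.map_add_eq_mul, inv_mul_cancel_left₀ hc0,
        nsmul_eq_mul]
      congr 1
      ring
  have h1 : (c : K) * (c : K)⁻¹ ^ d = 1 := by
    refine AddChar.to_mulShift_inj_of_isPrimitive (canonicalChar_isPrimitive p K) ?_
    ext y
    have := congrFun hfun (y ^ e)
    simp only [mul_pow, pow_pow_comm hde] at this
    simpa [AddChar.mulShift_apply, mul_assoc] using this
  rw [inv_pow, mul_inv_eq_one₀ (pow_ne_zero _ hc0)] at h1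
  exact h1.symm

/-- If all Weil sums are integers, then `x ↦ x ^ d` is additive on the prime field. -/
theorem pow_eq_self_of_weilSum_int (hde : ∀ x : K, (x ^ d) ^ e = x)
    (hW : ∀ a : K, ∃ w : ℤ, weilSum p K d a = w) (x : ZMod p) : x ^ d = x := by
  have hp : p.Prime := Fact.out
  rcases eq_or_ne x 0 with rfl | hx
  · exact zero_pow (ne_zero_of_pow_pow hde)
  · have hc : x.val.Coprime p := ZMod.val_coe_unit_coprime (Units.mk0 x hx)
    apply (algebraMap (ZMod p) K).injective
    have := natCast_pow_eq_of_weilSum_int p hde hW hc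
    rwa [← map_natCast (algebraMap (ZMod p) K), ZMod.natCast_zmod_val, ← map_pow] at this

end PrimeField

/-! ### Gauss sums and descent of divisibility to a subfield. -/

section Divisibility

theorem MulChar.isIntegral_apply {M : Type*} [CommMonoid M] [Finite M] (χ : MulChar M ℂ) (x : M) :
    IsIntegral ℤ (χ x) := by
  by_cases hx : IsUnit x
  · obtain ⟨u, rfl⟩ := hx
    refine IsIntegral.of_pow (n := orderOf u) (_root_.orderOf_pos u) ?_
    rw [← map_pow, ← Units.val_pow_eq_pow_val, pow_orderOf_eq_one, Units.val_one, map_one]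
    exact isIntegral_one
  · rw [χ.map_nonunit hx]
    exact isIntegral_zero

theorem sum_mulChar_apply_mul_inv {F : Type*} [Field F] [Finite F] [DecidableEq F]
    [Fintype (MulChar F ℂ)] (a : F) {b : F} (hb : b ≠ 0) :
    ∑ χ : MulChar F ℂ, χ a * χ⁻¹ b = if a = b then (Nat.card F : ℂ) - 1 else 0 := by
  simp_rw [MulChar.inv_apply', ← map_mul]
  split_ifs with h
  · rw [h, mul_inv_cancel₀ hb]
    simp only [map_one, Finset.sum_const, Finset.card_univ, nsmul_eq_mul, mul_one]
    rw [← Nat.card_eq_fintype_card, MulChar.card_eq_card_units_of_hasEnoughRootsOfUnity,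
      Nat.card_units, Nat.cast_sub Nat.card_pos, Nat.cast_one]
  · have hne : a * b⁻¹ ≠ 1 := fun h1 => h (eq_of_div_eq_one (by rwa [div_eq_mul_inv]))
    obtain ⟨η, hη⟩ := MulChar.exists_apply_ne_one_of_hasEnoughRootsOfUnity F ℂ hne
    have h1 : ∑ χ : MulChar F ℂ, χ (a * b⁻¹) = η (a * b⁻¹) * ∑ χ : MulChar F ℂ, χ (a * b⁻¹) := by
      rw [Finset.mul_sum]
      exact (Fintype.sum_bijective _ (Group.mulLeft_bijective η) _ _ fun χ => by simp).symm
    have h2 : (η (a * b⁻¹) - 1) * ∑ χ : MulChar F ℂ, χ (a * b⁻¹) = 0 := by linear_combination -h1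
    exact (mul_eq_zero.1 h2).resolve_left (sub_ne_zero.2 hη)

/-- The multiplicative character `χ ∘ N` of an extension field. -/
noncomputable def MulChar.compNorm {F : Type*} [Field F] (χ : MulChar F ℂ) (K : Type*) [Field K]
    [Algebra F K] : MulChar K ℂ :=
  MulChar.ofUnitHom (χ.toUnitHom.comp (Units.map (Algebra.norm F)))

theorem MulChar.compNorm_apply {F : Type*} [Field F] (χ : MulChar F ℂ) {K : Type*} [Field K]
    [Finite K] [Algebra F K] (x : K) : χ.compNorm K x = χ (Algebra.norm F x) := by
  rcases eq_or_ne x 0 with rfl | hx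
  · simp
  · lift x to Kˣ using hx.isUnit
    simp [compNorm]

theorem MulChar.compNorm_ne_one {F : Type*} [Field F] {χ : MulChar F ℂ} (hχ : χ ≠ 1) (K : Type*)
    [Field K] [Finite K] [Algebra F K] : χ.compNorm K ≠ 1 := by
  obtain ⟨u, hu⟩ := MulChar.ne_one_iff.1 hχ
  obtain ⟨v, rfl⟩ := FiniteField.unitsMap_norm_surjective F K u
  refine MulChar.ne_one_iff.2 ⟨v, ?_⟩
  rwa [MulChar.compNorm_apply]

theorem pow_of_algebra {F K : Type*} [Field F] [Field K] [Algebra F K] {d e : ℕ}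
    (hde : ∀ x : K, (x ^ d) ^ e = x) (x : F) : (x ^ d) ^ e = x :=
  (algebraMap F K).injective (by rw [map_pow, map_pow, hde])

variable (p : ℕ) [Fact p.Prime]

/-- The sum over `a` is a Gauss sum times `χ⁻¹ x`; writing `x = (x ^ d) ^ e` turns what remains into
the second Gauss sum. -/
theorem sum_weilSum_mul_mulChar {F : Type*} [Field F] [Fintype F] [Algebra (ZMod p) F] {d e : ℕ}
    (hde : ∀ x : F, (x ^ d) ^ e = x) {χ : MulChar F ℂ} (hχ : χ ≠ 1) :
    ∑ a, weilSum p F d a * χ a =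
      gaussSum χ (canonicalChar p F) * gaussSum (χ⁻¹ ^ e) (canonicalChar p F) := by
  have h1 : ∀ x : F, ∑ a, χ a * canonicalChar p F (a * x) =
      χ⁻¹ x * gaussSum χ (canonicalChar p F) := by
    intro x
    rcases eq_or_ne x 0 with rfl | hx
    · simp [MulChar.sum_eq_zero_of_ne_one hχ, MulChar.map_zero]
    · rw [gaussSum, Finset.mul_sum]
      conv_rhs => rw [← (mulRight_bijective₀ x hx).sum_comp]
      refine Finset.sum_congr rfl fun a _ => ?_
      rw [MulChar.inv_apply', ← mul_assoc, ← map_mul, mul_comm a x, inv_mul_cancel_left₀ hx]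
  rw [sum_weilSum_mul]
  simp_rw [h1]
  rw [gaussSum, gaussSum, Finset.mul_sum]
  conv_rhs => rw [← (pow_bijective hde).sum_comp]
  refine Finset.sum_congr rfl fun x _ => ?_
  rw [MulChar.pow_apply' _ (ne_zero_of_pow_pow' hde), ← map_pow, hde]
  ring

theorem mulChar_inv_pow_ne_one {F : Type*} [Field F] {d e : ℕ}
    (hde : ∀ x : F, (x ^ d) ^ e = x) {χ : MulChar F ℂ} (hχ : χ ≠ 1) : χ⁻¹ ^ e ≠ 1 := by
  intro h
  refine hχ (inv_eq_one.1 (MulChar.eq_one_iff.2 fun a => ?_))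
  have h1 := MulChar.eq_one_iff.1 h (a ^ d)
  rwa [MulChar.pow_apply_coe, ← map_pow, Units.val_pow_eq_pow_val, hde] at h1

variable {F : Type*} [Field F] [Fintype F] [Algebra (ZMod p) F]
  {K : Type*} [Field K] [Fintype K] [Algebra (ZMod p) K] [Algebra F K] [IsScalarTower (ZMod p) F K]
  {d e : ℕ}

theorem gaussSum_compNorm {χ : MulChar F ℂ} (hχ : χ ≠ 1) :
    gaussSum (χ.compNorm K) (canonicalChar p K) =
      (-1) ^ (Module.finrank F K - 1) * gaussSum χ (canonicalChar p F) ^ Module.finrank F K := by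
  rw [← hasseDavenport K hχ, gaussSum]
  refine Finset.sum_congr rfl fun α _ => ?_
  rw [MulChar.compNorm_apply, canonicalChar_apply, canonicalChar_apply, Algebra.trace_trace]

/-- Hasse–Davenport is applied to both Gauss sums, and the two signs cancel. -/
theorem sum_weilSum_mul_compNorm (hde : ∀ x : K, (x ^ d) ^ e = x) {χ : MulChar F ℂ} (hχ : χ ≠ 1) :
    ∑ a, weilSum p K d a * χ.compNorm K a =
      (gaussSum χ (canonicalChar p F) * gaussSum (χ⁻¹ ^ e) (canonicalChar p F)) ^
        Module.finrank F K := by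
  have h : (χ.compNorm K)⁻¹ ^ e = (χ⁻¹ ^ e).compNorm K := by
    ext x
    have he := ne_zero_of_pow_pow' hde
    rw [MulChar.compNorm_apply, MulChar.pow_apply' _ he, MulChar.pow_apply' _ he,
      MulChar.inv_apply', MulChar.inv_apply', MulChar.compNorm_apply, ← Units.val_inv_eq_inv_val,
      ← Units.coe_map, map_inv, Units.val_inv_eq_inv_val, Units.coe_map]
  rw [sum_weilSum_mul_mulChar p hde (MulChar.compNorm_ne_one hχ K), h, gaussSum_compNorm p hχ,
    gaussSum_compNorm p (mulChar_inv_pow_ne_one (pow_of_algebra hde) hχ), mul_pow,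
    mul_mul_mul_comm, ← mul_pow, neg_one_mul, neg_neg, one_pow, one_mul]

/-- Multiplicative Fourier inversion; the trivial character contributes the first moment, because
the Weil sum vanishes at `0`. -/
theorem card_sub_one_mul_weilSum [Fintype (MulChar F ℂ)] [DecidableEq (MulChar F ℂ)]
    (hde : ∀ x : F, (x ^ d) ^ e = x) {b : F} (hb : b ≠ 0) :
    ((Fintype.card F : ℂ) - 1) * weilSum p F d b = Fintype.card F +
      ∑ χ ∈ Finset.univ.erase (1 : MulChar F ℂ), χ⁻¹ b *
        (gaussSum χ (canonicalChar p F) * gaussSum (χ⁻¹ ^ e) (canonicalChar p F)) := by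
  classical
  have h1 : ∑ χ : MulChar F ℂ, χ⁻¹ b * ∑ a, weilSum p F d a * χ a =
      ((Fintype.card F : ℂ) - 1) * weilSum p F d b := by
    have : ∀ χ : MulChar F ℂ, χ⁻¹ b * ∑ a, weilSum p F d a * χ a =
        ∑ a, weilSum p F d a * (χ a * χ⁻¹ b) := fun χ => by
      rw [Finset.mul_sum]
      exact Finset.sum_congr rfl fun a _ => by ring
    simp_rw [this]
    rw [Finset.sum_comm]
    simp_rw [← Finset.mul_sum, sum_mulChar_apply_mul_inv _ hb]
    simp [mul_comm]
  rw [← h1, ← Finset.add_sum_erase _ _ (Finset.mem_univ 1)]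
  congr 1
  · rw [inv_one, MulChar.one_apply hb.isUnit, one_mul, ← sum_weilSum p hde]
    refine Finset.sum_congr rfl fun a _ => ?_
    rcases eq_or_ne a 0 with rfl | ha
    · simp [weilSum_zero p hde]
    · rw [MulChar.one_apply ha.isUnit, mul_one]
  · refine Finset.sum_congr rfl fun χ hχ => ?_
    rw [sum_weilSum_mul_mulChar p hde (Finset.ne_of_mem_erase hχ)]

/-- If the Weil sums over `K` are divisible by more than `√q`, then those over a subfield of even
degree `2 * h` cannot take the value `-p ^ h`. -/
theorem weilSum_ne_neg_pow (hde : ∀ x : K, (x ^ d) ^ e = x) {h k : ℕ}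
    (hF : Module.finrank (ZMod p) F = 2 * h) (hk : h * Module.finrank F K < k)
    (hW : ∀ a : K, ∃ z : ℂ, IsIntegral ℤ z ∧ weilSum p K d a = p ^ k * z) {b : F} (hb : b ≠ 0) :
    weilSum p F d b ≠ -p ^ h := by
  classical
  intro hcon
  have hp : p.Prime := Fact.out
  have hp0 : (p : ℂ) ≠ 0 := Nat.cast_ne_zero.2 hp.ne_zero
  have : Fintype (MulChar F ℂ) := Fintype.ofFinite _
  set m := Module.finrank F K
  have hm : 0 < m := Module.finrank_pos
  have hh : 0 < h := by
    have : 0 < Module.finrank (ZMod p) F := Module.finrank_pos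
    omega
  have hcard : Fintype.card F = p ^ (2 * h) := by
    rw [← hF, FiniteField.pow_finrank_eq_card]
  -- Since `k ≥ h * m + 1`, the `m`-th power of each Gauss product is divisible by `p ^ (h * m) * p
  -- = (p ^ h * π) ^ m`.
  obtain ⟨π, hπ⟩ := IsAlgClosed.exists_pow_nat_eq (p : ℂ) hm
  have hπ0 : π ≠ 0 := fun h0 => hp0 (by rw [← hπ, h0, zero_pow hm.ne'])
  have hπi : IsIntegral ℤ π := IsIntegral.of_pow hm (hπ ▸ isIntegral_natCast p)
  have hY : ∀ χ : MulChar F ℂ, χ ≠ 1 → IsIntegral ℤ ((gaussSum χ (canonicalChar p F) *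
      gaussSum (χ⁻¹ ^ e) (canonicalChar p F)) / (p ^ h * π)) := by
    intro χ hχ
    choose z hz hz' using hW
    have h1 := sum_weilSum_mul_compNorm p hde hχ
    refine IsIntegral.of_pow hm ?_
    have h2 : ((gaussSum χ (canonicalChar p F) *
        gaussSum (χ⁻¹ ^ e) (canonicalChar p F)) / (p ^ h * π)) ^ m =
        (p : ℂ) ^ (k - h * m - 1) * ∑ a, z a * χ.compNorm K a := by
      rw [div_pow, ← h1, div_eq_iff (by positivity), mul_pow, hπ, ← pow_mul, Finset.mul_sum,
        Finset.sum_mul]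
      refine Finset.sum_congr rfl fun a _ => ?_
      have h3 : (p : ℂ) ^ k = p ^ (k - h * m - 1) * (p ^ (h * m) * p) := by
        rw [← pow_succ, ← pow_add]
        congr 1
        omega
      rw [hz', h3]
      ring
    rw [h2]
    exact ((isIntegral_natCast p).pow _).mul
      (IsIntegral.sum _ fun a _ => (hz a).mul (MulChar.isIntegral_apply _ _))
  have hsum := card_sub_one_mul_weilSum p (pow_of_algebra hde) hb
  rw [hcon, hcard] at hsum
  -- The inversion formula at the value `-p ^ h`, divided by `p ^ h * π`.
  have hint : IsIntegral ℤ (((p : ℂ) ^ (2 * h) - 1) / π) := by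
    have h1 : ((p : ℂ) ^ (2 * h) - 1) / π = -(p ^ (h - 1) * π ^ (m - 1) +
        ∑ χ ∈ Finset.univ.erase (1 : MulChar F ℂ), χ⁻¹ b *
        ((gaussSum χ (canonicalChar p F) * gaussSum (χ⁻¹ ^ e) (canonicalChar p F)) /
          (p ^ h * π))) := by
      have h2 : (p : ℂ) ^ (h - 1) * π ^ (m - 1) = p ^ (2 * h) / (p ^ h * π) := by
        rw [eq_div_iff (by positivity), two_mul, pow_add,
          show (p : ℂ) ^ (h - 1) * π ^ (m - 1) * (p ^ h * π) =
            p ^ (h - 1) * p ^ h * (π ^ (m - 1) * π) by ring, pow_sub_one_mul hm.ne', hπ,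
          mul_right_comm, pow_sub_one_mul hh.ne']
      simp_rw [← mul_div_assoc]
      rw [h2, ← Finset.sum_div, ← add_div]
      push_cast at hsum
      rw [← hsum]
      field_simp
    rw [h1]
    refine ((((isIntegral_natCast p).pow _).mul (hπi.pow _)).add
      (IsIntegral.sum _ fun χ hχ => ?_)).neg
    exact (MulChar.isIntegral_apply _ _).mul (hY χ (Finset.ne_of_mem_erase hχ))
  -- The `m`-th power is rational, so `p` would divide `(p ^ (2 * h) - 1) ^ m`.
  have hint2 := hint.pow m
  rw [div_pow, hπ] at hint2
  have hr : ((p : ℂ) ^ (2 * h) - 1) ^ m / p =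
      algebraMap ℚ ℂ (((p : ℚ) ^ (2 * h) - 1) ^ m / p) := by simp
  rw [hr, isIntegral_algebraMap_iff (algebraMap ℚ ℂ).injective] at hint2
  obtain ⟨B, hB⟩ := IsIntegrallyClosed.isIntegral_iff.1 hint2
  have hpQ : (p : ℚ) ≠ 0 := Nat.cast_ne_zero.2 hp.ne_zero
  rw [eq_div_iff hpQ, eq_intCast] at hB
  have hdvd : (p : ℤ) ∣ ((p : ℤ) ^ (2 * h) - 1) ^ m := ⟨B, by
    rw [mul_comm (p : ℤ)]
    exact_mod_cast hB.symm⟩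
  have hpp : Prime (p : ℤ) := Nat.prime_iff_prime_int.1 hp
  have h1 := hpp.dvd_of_dvd_pow hdvd
  have h2 : (p : ℤ) ∣ 1 := by
    have := dvd_sub (dvd_pow_self (p : ℤ) (show 2 * h ≠ 0 by omega)) h1
    rwa [sub_sub_cancel] at this
  exact hpp.not_isUnit (isUnit_of_dvd_one h2)

end Divisibility

/-! ### Additivity across a quadratic extension. -/

section QuadraticStep

/-- A homogeneous function on a plane over a finite field that agrees with every linear form at
some nonzero vector is additive. -/
theorem map_add_of_forall_exists_eq {L V : Type*} [Field L] [Finite L] [AddCommGroup V] [Module L V]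
    (hV : Module.finrank L V = 2) {f : V → L} (hf : ∀ (r : L) (x : V), f (r • x) = r * f x)
    (hφ : ∀ φ : V →ₗ[L] L, ∃ x, x ≠ 0 ∧ f x = φ x) (x y : V) : f (x + y) = f x + f y := by
  have hf0 : f 0 = 0 := by simpa using hf 0 0
  rcases eq_or_ne y 0 with rfl | hy
  · simp [hf0]
  by_cases hxy : ∃ r : L, r • y = x
  · obtain ⟨r, rfl⟩ := hxy
    have h := hf (r + 1) y
    rw [add_smul, one_smul] at h
    rw [h, hf]
    ring
  have hli : LinearIndependent L ![y, x] := (LinearIndependent.pair_iff' hy).2 (not_exists.1 hxy)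
  let B := basisOfLinearIndependentOfCardEqFinrank hli (by simp [hV])
  have hB0 : B 0 = y := by simp [B]
  have hB1 : B 1 = x := by simp [B]
  by_contra hne
  set c := f (x + y) - f x with hc
  have hcy : c ≠ f y := fun h => hne (by rw [← h, hc]; ring)
  -- Given `v`, use the form with `y ↦ c`, `x ↦ v`. As `c ≠ f y`, it cannot meet `f` on the line of
  -- `y`, so the meeting point rescales to `x + s • y`. By the choice of `c`, the map takes equal
  -- values at `s = 0` and `s = 1`, contradicting finiteness.
  have hsurj : Function.Surjective fun s : L => f (x + s • y) - s * c := by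
    intro v
    obtain ⟨z, hz, hfz⟩ := hφ (B.constr L ![c, v])
    have hzB : z = B.repr z 0 • y + B.repr z 1 • x := by
      conv_lhs => rw [← B.sum_repr z]
      rw [Fin.sum_univ_two, hB0, hB1]
    have hφy : B.constr L ![c, v] y = c := by
      rw [← hB0, B.constr_basis]
      rfl
    have hφx : B.constr L ![c, v] x = v := by
      rw [← hB1, B.constr_basis]
      rfl
    have hr : B.repr z 1 ≠ 0 := by
      intro h1
      rw [h1, zero_smul, add_zero] at hzB
      have h0 : B.repr z 0 ≠ 0 := fun h0 => hz (by rw [hzB, h0, zero_smul])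
      rw [hzB, hf, map_smul, hφy, smul_eq_mul] at hfz
      exact hcy (mul_left_cancel₀ h0 hfz).symm
    have hz' : z = B.repr z 1 • (x + ((B.repr z 1)⁻¹ * B.repr z 0) • y) := by
      conv_lhs => rw [hzB]
      rw [smul_add, smul_smul, mul_inv_cancel_left₀ hr, add_comm]
    rw [hz', hf, map_smul, smul_eq_mul] at hfz
    have h2 := mul_left_cancel₀ hr hfz
    rw [map_add, map_smul, hφx, hφy, smul_eq_mul] at h2
    exact ⟨_, sub_eq_of_eq_add h2⟩
  have h01 := (Finite.injective_iff_surjective.2 hsurj) (a₁ := 0) (a₂ := 1) (by simp [hc])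
  exact zero_ne_one h01

variable (p : ℕ) [Fact p.Prime] {L : Type*} [Field L] [Algebra (ZMod p) L] {d e : ℕ}

/-- The power map is then an automorphism over the prime field, which preserves the trace. -/
theorem canonicalChar_pow_of_add (hde : ∀ x : L, (x ^ d) ^ e = x)
    (hL : ∀ x y : L, (x + y) ^ d = x ^ d + y ^ d) (x : L) :
    canonicalChar p L (x ^ d) = canonicalChar p L x := by
  let σ : L →+* L :=
    { toFun := fun x => x ^ d
      map_one' := one_pow d
      map_mul' := fun x y => mul_pow x y d
      map_zero' := zero_pow (ne_zero_of_pow_pow hde)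
      map_add' := hL }
  let τ : L →ₐ[ZMod p] L :=
    { σ with
      commutes' := fun r =>
        RingHom.congr_fun (Subsingleton.elim (σ.comp (algebraMap (ZMod p) L)) _) r }
  have h := Algebra.trace_eq_of_algEquiv (AlgEquiv.ofBijective τ (pow_bijective hde)) x
  rw [canonicalChar_apply, canonicalChar_apply, ← h]
  rfl

variable [Fintype L] {F : Type*} [Field F] [Fintype F] [Algebra (ZMod p) F] [Algebra L F]
  [IsScalarTower (ZMod p) L F]

/-- The term `r ^ d * Tr (x ^ d)` is the `d`-th power of `r * Tr (x ^ d) ^ e`, and the character on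
`L` ignores `d`-th powers. The phase thus becomes linear in `r`. -/
theorem canonicalChar_smul_pow_add (hde : ∀ x : F, (x ^ d) ^ e = x)
    (hL : ∀ x y : L, (x + y) ^ d = x ^ d + y ^ d) (b x : F) (r : L) :
    canonicalChar p F ((r • x) ^ d + b * r • x) = canonicalChar p L
      (r * (Algebra.trace L F (x ^ d) ^ e + Algebra.trace L F (b * x))) := by
  have hdeL : ∀ x : L, (x ^ d) ^ e = x := pow_of_algebra hde
  have h1 : ∀ y : F, canonicalChar p F y = canonicalChar p L (Algebra.trace L F y) := fun y => by
    rw [canonicalChar_apply, canonicalChar_apply, Algebra.trace_trace]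
  rw [h1, map_add, smul_pow, map_smul, mul_smul_comm, map_smul, AddChar.map_add_eq_mul, mul_add,
    AddChar.map_add_eq_mul, ← canonicalChar_pow_of_add p hdeL hL (r * Algebra.trace L F (x ^ d) ^ e),
    mul_pow, pow_pow_comm hdeL]
  rfl

/-- If `x ↦ x ^ d` is additive on `L` but not on its quadratic extension `F`, then `-|L|` is a
value of the Weil sum over `F`. -/
theorem add_pow_of_weilSum_ne (hde : ∀ x : F, (x ^ d) ^ e = x)
    (hL : ∀ x y : L, (x + y) ^ d = x ^ d + y ^ d) (hLF : Module.finrank L F = 2)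
    (hW : ∀ b : F, weilSum p F d b ≠ -Fintype.card L) (x y : F) :
    (x + y) ^ d = x ^ d + y ^ d := by
  classical
  have hdeL : ∀ x : L, (x ^ d) ^ e = x := pow_of_algebra hde
  have hd := ne_zero_of_pow_pow hde
  have he := ne_zero_of_pow_pow' hde
  have hcard : Fintype.card F = Fintype.card L ^ 2 := by
    rw [← hLF, Module.card_eq_pow_finrank (K := L)]
  -- Sum over `r` in `L` in two ways. If `x = 0` were the only zero, then `|L| ^ 2 + (|L| - 1) * W =
  -- |L|`, that is, `W = -|L|`.
  have hzero : ∀ b : F, ∃ x : F, x ≠ 0 ∧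
      Algebra.trace L F (x ^ d) ^ e + Algebra.trace L F (b * x) = 0 := by
    intro b
    by_contra! hcon
    refine hW b ?_
    have h1 : ∑ r : L, ∑ x : F, canonicalChar p F ((r • x) ^ d + b * r • x) =
        (Fintype.card L : ℂ) ^ 2 + ((Fintype.card L : ℂ) - 1) * weilSum p F d b := by
      rw [← Finset.add_sum_erase _ _ (Finset.mem_univ (0 : L))]
      congr 1
      · simp [hd, hcard]
      · have : ∀ r ∈ Finset.univ.erase (0 : L),
            ∑ x : F, canonicalChar p F ((r • x) ^ d + b * r • x) = weilSum p F d b := by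
          intro r hr
          exact (MulAction.bijective₀ (Finset.ne_of_mem_erase hr)).sum_comp
            fun x : F => canonicalChar p F (x ^ d + b * x)
        rw [Finset.sum_congr rfl this, Finset.sum_const, Finset.card_erase_of_mem (Finset.mem_univ _),
          nsmul_eq_mul, Finset.card_univ, Nat.cast_sub Fintype.card_pos, Nat.cast_one]
    have h2 : ∑ r : L, ∑ x : F, canonicalChar p F ((r • x) ^ d + b * r • x) = Fintype.card L := by
      simp_rw [canonicalChar_smul_pow_add p hde hL]
      rw [Finset.sum_comm]
      simp_rw [AddChar.sum_mulShift _ (canonicalChar_isPrimitive p L)]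
      rw [Finset.sum_eq_single 0]
      · simp [hd, he]
      · intro x _ hx
        rw [if_neg (hcon x hx), Nat.cast_zero]
      · simp
    rw [h1] at h2
    have h3 : ((Fintype.card L : ℂ) - 1) ≠ 0 := by
      rw [sub_ne_zero, Ne, Nat.cast_eq_one]
      exact Fintype.one_lt_card.ne'
    refine mul_left_cancel₀ h3 ?_
    linear_combination h2
  have hadd := map_add_of_forall_exists_eq hLF (f := fun x : F => Algebra.trace L F (x ^ d) ^ e)
    (fun r x => by
      rw [smul_pow, map_smul, smul_eq_mul, mul_pow, hdeL])
    (fun φ => by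
      obtain ⟨b, hb⟩ := (Algebra.traceForm L F).toDual (traceForm_nondegenerate L F)
        |>.surjective φ
      obtain ⟨x, hx, h⟩ := hzero (-b)
      refine ⟨x, hx, ?_⟩
      rw [← hb, LinearMap.BilinForm.toDual_def, Algebra.traceForm_apply]
      rw [neg_mul, map_neg] at h
      linear_combination h)
  have htr : ∀ x y : F, Algebra.trace L F ((x + y) ^ d) =
      Algebra.trace L F (x ^ d) + Algebra.trace L F (y ^ d) := by
    intro x y
    have h := congrArg (· ^ d) (hadd x y)
    simpa only [hL, pow_pow_comm hdeL] using h
  rw [← sub_eq_zero]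
  refine (traceForm_nondegenerate L F).1 _ fun c => ?_
  -- The factor `c ^ e` becomes `c` after the `d`-th power, so the additivity defect is
  -- trace-orthogonal to every `c`.
  have h := htr (c ^ e * x) (c ^ e * y)
  rw [← mul_add, mul_pow, mul_pow, mul_pow, pow_pow_comm hde] at h
  rw [Algebra.traceForm_apply, mul_comm, mul_sub, mul_add, map_sub, map_add, h, sub_self]

end QuadraticStep

/-! ### The tower of quadratic extensions and the final bound. -/

section Main

theorem exists_pow_pow_eq_self {K : Type*} [Field K] [Fintype K] {d : ℕ} (hd0 : d ≠ 0)
    (hd : d.Coprime (Fintype.card K - 1)) : ∃ e : ℕ, ∀ x : K, (x ^ d) ^ e = x := by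
  have hpos : 0 < Fintype.card K - 1 := Nat.sub_pos_of_lt Fintype.one_lt_card
  obtain ⟨e, he0, he⟩ : ∃ e : ℕ, e ≠ 0 ∧ d * e ≡ 1 [MOD Fintype.card K - 1] := by
    refine ⟨d ^ (Nat.totient (Fintype.card K - 1) - 1), pow_ne_zero _ hd0, ?_⟩
    rw [mul_pow_sub_one (Nat.totient_pos.2 hpos).ne']
    exact Nat.ModEq.pow_totient hd
  refine ⟨e, fun x => ?_⟩
  rw [← pow_mul]
  rcases eq_or_ne x 0 with rfl | hx
  · exact zero_pow (mul_ne_zero hd0 he0)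
  · have h1 : x ^ (d * e) = x ^ 1 := by
      lift x to Kˣ using hx.isUnit
      rw [← Units.val_pow_eq_pow_val, ← Units.val_pow_eq_pow_val, Units.val_inj]
      refine pow_eq_pow_iff_modEq.2 (he.of_dvd (orderOf_dvd_of_pow_eq_one ?_))
      exact Units.ext (by simpa using FiniteField.pow_card_sub_one_eq_one (x : K) hx)
    rw [h1, pow_one]

variable (p : ℕ) [Fact p.Prime] {K : Type*} [Field K] [Fintype K] [Algebra (ZMod p) K] {d e : ℕ}

/-- If the Weil sums take only the values `0` and `±p ^ k` with `p ^ k > √q`, then `x ↦ x ^ d` is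
additive on every subfield whose degree is a power of two. -/
theorem add_pow_galoisField (hde : ∀ x : K, (x ^ d) ^ e = x) {k : ℕ}
    (hk : Module.finrank (ZMod p) K < 2 * k)
    (hW : ∀ a : K, weilSum p K d a = 0 ∨ weilSum p K d a = p ^ k ∨ weilSum p K d a = -p ^ k)
    (t : ℕ) (ht : 2 ^ t ∣ Module.finrank (ZMod p) K) (x y : GaloisField p (2 ^ t)) :
    (x + y) ^ d = x ^ d + y ^ d := by
  have h2 : ∀ t : ℕ, 2 ^ t ≠ 0 := fun t => pow_ne_zero t two_ne_zero
  induction t with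
  | zero =>
    have hself := pow_eq_self_of_weilSum_int p hde fun a => by
      rcases hW a with h | h | h
      · exact ⟨0, by simp [h]⟩
      · exact ⟨p ^ k, by simp [h]⟩
      · exact ⟨-p ^ k, by simp [h]⟩
    have hbij : Function.Surjective (algebraMap (ZMod p) (GaloisField p (2 ^ 0))) :=
      ((algebraMap (ZMod p) (GaloisField p (2 ^ 0))).injective.bijective_of_nat_card_le
        (by rw [GaloisField.card p _ (h2 0), Nat.card_zmod, pow_zero, pow_one])).2
    obtain ⟨x, rfl⟩ := hbij x
    obtain ⟨y, rfl⟩ := hbij y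
    simp only [← map_add, ← map_pow, hself]
  | succ t ih =>
    let L := GaloisField p (2 ^ t)
    let F := GaloisField p (2 ^ (t + 1))
    let _ : Fintype L := Fintype.ofFinite L
    let _ : Fintype F := Fintype.ofFinite F
    have hL : Module.finrank (ZMod p) L = 2 ^ t := GaloisField.finrank p (h2 t)
    have hF : Module.finrank (ZMod p) F = 2 * 2 ^ t := by
      rw [← pow_succ']
      exact GaloisField.finrank p (h2 (t + 1))
    obtain ⟨i⟩ : Nonempty (L →ₐ[ZMod p] F) :=
      FiniteField.nonempty_algHom_of_finrank_dvd (by rw [hL, hF]; exact Dvd.intro_left _ rfl)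
    obtain ⟨j⟩ : Nonempty (F →ₐ[ZMod p] K) :=
      FiniteField.nonempty_algHom_of_finrank_dvd (by rw [hF, ← pow_succ']; exact ht)
    let _ : Algebra L F := i.toRingHom.toAlgebra
    let _ : Algebra F K := j.toRingHom.toAlgebra
    have : IsScalarTower (ZMod p) L F := .of_algebraMap_eq fun r => (i.commutes r).symm
    have : IsScalarTower (ZMod p) F K := .of_algebraMap_eq fun r => (j.commutes r).symm
    have hLF : Module.finrank L F = 2 := by
      have h := Module.finrank_mul_finrank (ZMod p) L F
      rw [hL, hF, mul_comm] at h
      exact Nat.eq_of_mul_eq_mul_right (Nat.pos_of_ne_zero (h2 t)) h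
    have hFK : 2 * 2 ^ t * Module.finrank F K = Module.finrank (ZMod p) K := by
      rw [← hF]
      exact Module.finrank_mul_finrank (ZMod p) F K
    have hdeF : ∀ x : F, (x ^ d) ^ e = x := pow_of_algebra hde
    have hcardL : Fintype.card L = p ^ 2 ^ t := by
      rw [← hL, FiniteField.pow_finrank_eq_card]
    refine add_pow_of_weilSum_ne p hdeF (ih ((pow_dvd_pow 2 t.le_succ).trans ht)) hLF
      (fun b => ?_) x y
    rw [hcardL, Nat.cast_pow]
    rcases eq_or_ne b 0 with rfl | hb
    · rw [weilSum_zero p hdeF]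
      exact (neg_ne_zero.2 (pow_ne_zero _ (Nat.cast_ne_zero.2 (Fact.out : p.Prime).ne_zero))).symm
    · refine weilSum_ne_neg_pow p (k := k) hde hF (by rw [mul_assoc] at hFK; omega)
        (fun a => ?_) hb
      rcases hW a with h | h | h
      · exact ⟨0, isIntegral_zero, by simp [h]⟩
      · exact ⟨1, isIntegral_one, by simp [h]⟩
      · exact ⟨-1, isIntegral_one.neg, by simp [h]⟩

end Main

theorem mainTheorem2 (p : ℕ) [Fact p.Prime] (K : Type*) [Field K] [Fintype K]
    [Algebra (ZMod p) K] (q : ℕ) (hq : Fintype.card K = q)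
    (d : ℕ) (hd : Nat.Coprime d (q - 1))
    (s : ℕ) (hs : padicValNat 2 (Module.finrank (ZMod p) K) = s)
    (A : ℂ) (h3 : IsThreeValued p K d) (hA : weilValueSet p K d = {0, A, -A}) :
    (p : ℝ) ^ ((2 : ℝ) ^ ((s : ℝ) - 1)) * √(q : ℝ) ≤ ‖A‖ := by
  subst hq hs
  have hp : p.Prime := Fact.out
  -- For `d = 0` coprimality gives `q = 2`, leaving a single value.
  have hd0 : d ≠ 0 := by
    rintro rfl
    rw [Nat.coprime_zero_left] at hd
    have : Subsingleton Kˣ := Finite.card_le_one_iff_subsingleton.1 (by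
      rw [Nat.card_units, Nat.card_eq_fintype_card, hd])
    have h1 : (weilValueSet p K 0).ncard ≤ 1 :=
      (Set.ncard_le_one (Set.finite_range _)).2 fun a ha b hb => Set.subsingleton_range _ ha hb
    rw [IsThreeValued] at h3
    omega
  obtain ⟨e, hde⟩ := exists_pow_pow_eq_self hd0 hd
  have hW : ∀ a : K, weilSum p K d a = 0 ∨ weilSum p K d a = A ∨ weilSum p K d a = -A := by
    intro a
    rcases eq_or_ne a 0 with rfl | ha
    · exact .inl (weilSum_zero p hde)
    · have : weilSum p K d a ∈ weilValueSet p K d := ⟨Units.mk0 a ha, rfl⟩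
      rwa [hA] at this
  have hAint : IsIntegral ℤ A := by
    have : A ∈ weilValueSet p K d := by rw [hA]; simp
    obtain ⟨a, rfl⟩ := this
    exact isIntegral_weilSum p _
  obtain ⟨k, hk, hAk⟩ := exists_eq_pow_of_weilSum_eq p hde hW hAint
  have hW' : ∀ a : K, weilSum p K d a = 0 ∨ weilSum p K d a = p ^ k ∨
      weilSum p K d a = -p ^ k := by
    intro a
    rcases hAk with rfl | rfl
    · exact hW a
    · have := hW a
      rw [neg_neg] at this
      tauto
  set s := padicValNat 2 (Module.finrank (ZMod p) K)
  have hs : 2 ^ s ∣ Module.finrank (ZMod p) K := pow_padicValNat_dvd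
  let _ : Fintype (GaloisField p (2 ^ s)) := Fintype.ofFinite _
  have h2 : 2 ^ s ≠ 0 := pow_ne_zero s two_ne_zero
  obtain ⟨i⟩ : Nonempty (GaloisField p (2 ^ s) →ₐ[ZMod p] K) :=
    FiniteField.nonempty_algHom_of_finrank_dvd (by rwa [GaloisField.finrank p h2])
  have hle := card_mul_card_le_norm_sq p hde hW i.toRingHom (add_pow_galoisField p hde hk hW' s hs)
  rw [← Nat.card_eq_fintype_card, GaloisField.card p _ h2] at hle
  -- Squaring doubles the exponent `2 ^ (s - 1)` to `2 ^ s`, the degree of the subfield.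
  refine le_of_sq_le_sq ?_ (norm_nonneg A)
  refine le_trans (le_of_eq ?_) hle
  rw [mul_pow, Real.sq_sqrt (Nat.cast_nonneg _), ← Real.rpow_natCast, ← Real.rpow_mul (by positivity)]
  congr 1
  rw [Real.rpow_sub_one two_ne_zero, Real.rpow_natCast, Nat.cast_two, div_mul_cancel₀ _ two_ne_zero]
  push_cast
  exact_mod_cast Real.rpow_natCast (p : ℝ) (2 ^ s)
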